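/- For $d\in\mathbb{N}$, $d\ge 1$, let $P_d=\{x\in\mathbb{R}^d : x_i\ge 0,\ \sum_i x_i=1\}$ be the set of $d$-dimensional probability vectors, and identify $x\in P_d$ with $(x_1,\dots,x_d,0)\in P_{d+1}$. For $x,y\in P_d$ write $x\prec y$ ($x$ is majorized by $y$) if $\sum_{i=1}^k x_i^\downarrow\le\sum_{i=1}^k y_i^\downarrow$ for all $1\le k\le d$, where $x^\downarrow$ denotes the decreasing rearrangement of $x$. The tensor power $x^{\otimes n}\in P_{d^n}$ is the vector of all products $x_{i_1}\cdots x_{i_n}$, $1\le i_1,\dots,i_n\le d$. Write $x\prec_M y$ ($x$ is multiple-copy majorized by $y$) if $x^{\otimes n}\prec y^{\otimes n}$ for some $n\ge 2$ (this includes the case $x\prec y$), and let $M_d(y)=\{x\in P_d : x\prec_M y\}$. For $p\in\mathbb{R}$ let $N_p(x)=\sum_{i:\,x_i>0}x_i^p$. **Theorem.** Let $x,y\in P_d$ be such that - $N_p(x)\le N_p(y)$ for all real $p\ge 1$, and - $N_p(x)\ge N_p(y)$ for all real $p$ with $0<p\le 1$. Then there exists a sequence $(x_n)$ in $M_{d+1}(y)$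 that converges to $x$ in $\mathbb{R}^{d+1}$ (where $x$ and $y$ are regarded as elements of $P_{d+1}$ by appending a zero). -/

import Mathlib

namespace MultiCopy

/-- The decreasing rearrangement of a finite real vector `x`, as the list of all its coordinates
(with multiplicity) sorted in decreasing order. -/
noncomputable def decreasingRearrangement {ι : Type*} [Fintype ι] (x : ι → ℝ) : List ℝ :=
  ((Finset.univ : Finset ι).val.map x).sort (· ≥ ·)

/-- Majorization `x ≺ y` of probability vectors of the same dimension: for every `k` from `1` to
the dimension, the sum of the `k` largest coordinates of `x` is at most that of `y`.
(The total sums of probability vectors agree automatically.) -/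
def Majorized {ι : Type*} [Fintype ι] (x y : ι → ℝ) : Prop :=
  ∀ k : ℕ, 1 ≤ k → k ≤ Fintype.card ι →
    ((decreasingRearrangement x).take k).sum ≤ ((decreasingRearrangement y).take k).sum

/-- The tensor power `x^{⊗ n}`: its coordinates are the products `x_{f 0} ⋯ x_{f (n-1)}`,
indexed by all `n`-tuples `f` of indices. -/
def tensorPower {ι : Type*} (n : ℕ) (x : ι → ℝ) : (Fin n → ι) → ℝ :=
  fun f => ∏ j, x (f j)

/-- Multiple-copy majorization `x ≺_M y`: `x^{⊗ n} ≺ y^{⊗ n}` for some `n ≥ 2`. (Ordinary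
majorization `x ≺ y` is included, since it implies `x ⊗ x ≺ y ⊗ y`.) -/
def MultiCopyMajorized {ι : Type*} [Fintype ι] (x y : ι → ℝ) : Prop :=
  ∃ n : ℕ, 2 ≤ n ∧ Majorized (tensorPower n x) (tensorPower n y)

/-- `M_d(y)`: the `d`-dimensional probability vectors multiple-copy majorized by `y`. -/
def M {d : ℕ} (y : Fin d → ℝ) : Set (Fin d → ℝ) :=
  {x | x ∈ stdSimplex ℝ (Fin d) ∧ MultiCopyMajorized x y}

/-- The vector `(x_1, …, x_d, 0)`, by which a `d`-dimensional vector is regarded as a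
`(d+1)`-dimensional one. -/
def appendZero {d : ℕ} (x : Fin d → ℝ) : Fin (d + 1) → ℝ :=
  Fin.snoc (α := fun _ => ℝ) x 0

/-- `N_p(x)`: the sum of `x_i ^ p` over the indices with `x_i > 0`. -/
noncomputable def N {d : ℕ} (p : ℝ) (x : Fin d → ℝ) : ℝ :=
  ∑ i with 0 < x i, x i ^ p

end MultiCopy

/-! Give the point `log (x i)` mass `x i`. The exponential moments of this measure are the sums `N
(1 + l) x`, and its `n`-fold convolution describes `x^{⊗ n}`: a tail is the sum of the entries above
a threshold. Domination of all these threshold sums forces majorization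
(`majorized_of_sum_filter_le`), so it suffices that a high convolution power for `x` is
stochastically below the one for `y`.

By Cramér's theorem such an ordering follows from strict comparison of all exponential moments, the
means and the extreme points (`eventually_forall_upperTail_le`). The hypotheses are only weak and
say nothing for `p ≤ 0`. Replacing `x` by `((1 - ε) x, ε)` repairs both: a small new coordinate
strictly lowers the moments with `p > 1`, raises those with `p < 1`, lowers the mean and provides a
strict minimum. For `p ≤ 0` its contribution `ε ^ p` beats the moment of `y`
(`eventually_logMoment_lt_add`). Letting `ε → 0` gives the sequence. -/

namespace MultiCopy

open Filter Topology Finset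

/-! ### Large deviations and stochastic ordering of convolution powers -/

section Tails

variable {ι κ : Type*} [Fintype ι] [Fintype κ]

/-- The exponential moment `∑ wᵢ exp (l (vᵢ - t))` of the weighted points `(wᵢ, vᵢ)`, centred
at `t`. -/
noncomputable def centredMoment (w v : ι → ℝ) (t l : ℝ) : ℝ :=
  ∑ i, w i * Real.exp (l * (v i - t))

/-- The derivative in `l` of `centredMoment w v t l`. -/
noncomputable def centredMomentDeriv (w v : ι → ℝ) (t l : ℝ) : ℝ :=
  ∑ i, w i * ((v i - t) * Real.exp (l * (v i - t)))

open Classical in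
/-- The mass that the `n`-fold convolution of the weighted points `(wᵢ, vᵢ)` gives
to `[n t, ∞)`. -/
noncomputable def upperTail (w v : ι → ℝ) (n : ℕ) (t : ℝ) : ℝ :=
  ∑ f : Fin n → ι with n * t ≤ ∑ j, v (f j), ∏ j, w (f j)

lemma hasDerivAt_centredMoment (w v : ι → ℝ) (t l : ℝ) :
    HasDerivAt (centredMoment w v t) (centredMomentDeriv w v t l) l := by
  unfold centredMomentDeriv
  have : centredMoment w v t = fun l => ∑ i, w i * Real.exp (l * (v i - t)) := rfl
  rw [this]
  refine HasDerivAt.fun_sum fun i _ => ?_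
  have h := (((hasDerivAt_id l).mul_const (v i - t)).exp).const_mul (w i)
  simpa [mul_comm] using h

lemma centredMoment_pos {w v : ι → ℝ} (hw : ∀ i, 0 ≤ w i) (hw1 : ∑ i, w i = 1) (t l : ℝ) :
    0 < centredMoment w v t l := by
  have hne : ∃ i, 0 < w i := by
    by_contra! h
    have : ∑ i, w i ≤ 0 := Finset.sum_nonpos fun i _ => h i
    linarith
  obtain ⟨i, hi⟩ := hne
  exact Finset.sum_pos' (fun i _ => mul_nonneg (hw i) (Real.exp_pos _).le)
    ⟨i, mem_univ i, mul_pos hi (Real.exp_pos _)⟩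

lemma centredMoment_zero {w : ι → ℝ} (v : ι → ℝ) (hw1 : ∑ i, w i = 1) (t : ℝ) :
    centredMoment w v t 0 = 1 := by
  simp [centredMoment, hw1]

lemma centredMoment_shift (w v : ι → ℝ) (s t l : ℝ) :
    centredMoment w v s l = Real.exp (-(l * (s - t))) * centredMoment w v t l := by
  unfold centredMoment
  rw [Finset.mul_sum]
  refine Finset.sum_congr rfl fun i _ => ?_
  rw [mul_left_comm, ← Real.exp_add]
  congr 2; ring

/-- The mean of the points `vᵢ` under the weights `wᵢ exp (l vᵢ)`. -/
noncomputable def tiltedMean (w v : ι → ℝ) (l : ℝ) : ℝ :=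
  (∑ i, w i * (v i * Real.exp (l * v i))) / centredMoment w v 0 l

/-- The sign of the derivative tells on which side of `t` the tilted mean lies; this links
minimizing the Chernoff bound to choosing a tilt. -/
lemma centredMomentDeriv_eq {w v : ι → ℝ} (hw : ∀ i, 0 ≤ w i) (hw1 : ∑ i, w i = 1) (t l : ℝ) :
    centredMomentDeriv w v t l = centredMoment w v t l * (tiltedMean w v l - t) := by
  have hpos := centredMoment_pos (v := v) hw hw1 0 l
  have h1 : centredMomentDeriv w v t l = Real.exp (-(l * t)) *
      ((∑ i, w i * (v i * Real.exp (l * v i))) - t * centredMoment w v 0 l) := by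
    unfold centredMoment centredMomentDeriv
    rw [Finset.mul_sum, ← Finset.sum_sub_distrib, Finset.mul_sum]
    refine Finset.sum_congr rfl fun i _ => ?_
    have : Real.exp (l * (v i - t)) = Real.exp (-(l * t)) * Real.exp (l * v i) := by
      rw [← Real.exp_add]; congr 1; ring
    rw [this, sub_zero]; ring
  rw [h1, centredMoment_shift w v t 0, sub_zero, tiltedMean]
  field_simp

lemma continuous_tiltedMean {w v : ι → ℝ} (hw : ∀ i, 0 ≤ w i) (hw1 : ∑ i, w i = 1) :
    Continuous (tiltedMean w v) := by
  unfold tiltedMean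
  refine Continuous.div (by fun_prop) (by unfold centredMoment; fun_prop) fun l => ?_
  exact (centredMoment_pos hw hw1 0 l).ne'

lemma sum_prod_mul_exp (w v : ι → ℝ) (t l : ℝ) (n : ℕ) :
    ∑ f : Fin n → ι, (∏ j, w (f j)) * Real.exp (l * (∑ j, v (f j) - n * t)) =
      centredMoment w v t l ^ n := by
  rw [centredMoment, Fintype.sum_pow]
  refine Finset.sum_congr rfl fun f _ => ?_
  rw [Finset.prod_mul_distrib, ← Real.exp_sum]
  congr 2
  rw [← Finset.mul_sum, Finset.sum_sub_distrib]
  simp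

lemma sum_prod_eq_one {w : ι → ℝ} (hw1 : ∑ i, w i = 1) (n : ℕ) :
    ∑ f : Fin n → ι, ∏ j, w (f j) = 1 := by
  rw [← Fintype.sum_pow, hw1, one_pow]

lemma upperTail_le_one {w : ι → ℝ} (v : ι → ℝ) (hw : ∀ i, 0 ≤ w i) (hw1 : ∑ i, w i = 1)
    (n : ℕ) (t : ℝ) : upperTail w v n t ≤ 1 := by
  rw [← sum_prod_eq_one hw1 n]
  exact Finset.sum_le_sum_of_subset_of_nonneg (Finset.subset_univ _)
    fun f _ _ => Finset.prod_nonneg fun j _ => hw _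

lemma upperTail_anti {w : ι → ℝ} (v : ι → ℝ) (hw : ∀ i, 0 ≤ w i) (n : ℕ) {s t : ℝ} (hst : s ≤ t) :
    upperTail w v n t ≤ upperTail w v n s := by
  refine Finset.sum_le_sum_of_subset_of_nonneg ?_
    fun f _ _ => Finset.prod_nonneg fun j _ => hw _
  refine Finset.monotone_filter_right _ fun f _ hf => ?_
  exact (mul_le_mul_of_nonneg_left hst (Nat.cast_nonneg n)).trans hf

/-- Chernoff's bound. -/
lemma upperTail_le_pow {w : ι → ℝ} (v : ι → ℝ) (hw : ∀ i, 0 ≤ w i) (n : ℕ) (t : ℝ) {l : ℝ}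
    (hl : 0 ≤ l) : upperTail w v n t ≤ centredMoment w v t l ^ n := by
  rw [← sum_prod_mul_exp, upperTail, Finset.sum_filter]
  refine Finset.sum_le_sum fun f _ => ?_
  have hW : 0 ≤ ∏ j, w (f j) := Finset.prod_nonneg fun j _ => hw _
  split_ifs with h
  · exact le_mul_of_one_le_right hW (Real.one_le_exp (mul_nonneg hl (by linarith)))
  · positivity

lemma eventually_pow_le_mul_pow {a b : ℝ} (ha : 0 ≤ a) (hab : a < b) {c : ℝ} (hc : 0 < c) :
    ∀ᶠ n : ℕ in atTop, a ^ n ≤ c * b ^ n := by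
  have hb : 0 < b := ha.trans_lt hab
  have h := tendsto_pow_atTop_nhds_zero_of_lt_one (div_nonneg ha hb.le) ((div_lt_one hb).2 hab)
  filter_upwards [h.eventually (gt_mem_nhds hc)] with n hn
  rw [div_pow, div_lt_iff₀ (pow_pos hb n)] at hn
  exact hn.le

lemma eventually_lt_right_of_hasDerivAt_neg {f : ℝ → ℝ} {f' x : ℝ} (h : HasDerivAt f f' x)
    (hf : f' < 0) : ∀ᶠ z in 𝓝[>] x, f z < f x := by
  have h1 := (hasDerivAt_iff_tendsto_slope.1 h).mono_left
    (nhdsWithin_mono x (fun z (hz : x < z) => hz.ne'))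
  filter_upwards [h1.eventually (gt_mem_nhds hf), self_mem_nhdsWithin] with z hz hxz
  have hxz : 0 < z - x := sub_pos.2 hxz
  rw [slope_def_field, div_lt_iff₀ hxz] at hz
  linarith

lemma eventually_lt_left_of_hasDerivAt_pos {f : ℝ → ℝ} {f' x : ℝ} (h : HasDerivAt f f' x)
    (hf : 0 < f') : ∀ᶠ z in 𝓝[<] x, f z < f x := by
  have h1 := (hasDerivAt_iff_tendsto_slope.1 h).mono_left
    (nhdsWithin_mono x (fun z (hz : z < x) => hz.ne))
  filter_upwards [h1.eventually (lt_mem_nhds hf), self_mem_nhdsWithin] with z hz hxz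
  have hxz : 0 < x - z := sub_pos.2 hxz
  rw [slope_comm, slope_def_field, lt_div_iff₀ hxz] at hz
  linarith

/-- The lower bound in Cramér's theorem, by tilting. -/
lemma eventually_pow_le_upperTail {w v : ι → ℝ} (hw : ∀ i, 0 ≤ w i) (hw1 : ∑ i, w i = 1)
    {s t l : ℝ} (hl : 0 ≤ l) (ht : t < tiltedMean w v l) (hs : tiltedMean w v l < s) :
    ∀ᶠ n : ℕ in atTop, 1 / 2 * centredMoment w v s l ^ n ≤ upperTail w v n t := by
  have hst : t < s := ht.trans hs
  have hKs := centredMoment_pos (v := v) hw hw1 s l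
  have hDt : 0 < centredMomentDeriv w v t l := by
    rw [centredMomentDeriv_eq hw hw1]
    exact mul_pos (centredMoment_pos hw hw1 _ _) (sub_pos.2 ht)
  have hDs : centredMomentDeriv w v s l < 0 := by
    rw [centredMomentDeriv_eq hw hw1]
    exact mul_neg_of_pos_of_neg (centredMoment_pos hw hw1 _ _) (sub_neg.2 hs)
  -- Sums below `n t` are controlled by a smaller tilt `a`, sums above `n s` by a larger tilt `b`.
  -- Each part is at most a quarter of the total, so half remains between the two levels, where the
  -- exponential factor is at most 1.
  obtain ⟨a, ha, hal⟩ := ((eventually_lt_left_of_hasDerivAt_pos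
    (hasDerivAt_centredMoment w v t l) hDt).and self_mem_nhdsWithin).exists
  obtain ⟨b, hb, hbl⟩ := ((eventually_lt_right_of_hasDerivAt_neg
    (hasDerivAt_centredMoment w v s l) hDs).and self_mem_nhdsWithin).exists
  have hal : a < l := hal
  have hbl : l < b := hbl
  have hA : Real.exp (-(l * (s - t))) * centredMoment w v t a < centredMoment w v s l := by
    rw [centredMoment_shift w v s t l]
    exact mul_lt_mul_of_pos_left ha (Real.exp_pos _)
  have hA0 : 0 ≤ Real.exp (-(l * (s - t))) * centredMoment w v t a :=
    mul_nonneg (Real.exp_pos _).le (centredMoment_pos hw hw1 _ _).le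
  filter_upwards [eventually_pow_le_mul_pow hA0 hA (show (0 : ℝ) < 1 / 4 by norm_num),
    eventually_pow_le_mul_pow (centredMoment_pos hw hw1 _ _).le hb (show (0 : ℝ) < 1 / 4 by norm_num)]
    with n hn1 hn2
  have key : centredMoment w v s l ^ n ≤
      (Real.exp (-(l * (s - t))) * centredMoment w v t a) ^ n + centredMoment w v s b ^ n
        + upperTail w v n t := by
    rw [mul_pow, ← sum_prod_mul_exp, ← sum_prod_mul_exp, ← sum_prod_mul_exp, upperTail,
      Finset.sum_filter, ← Real.exp_nat_mul, Finset.mul_sum, ← Finset.sum_add_distrib,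
      ← Finset.sum_add_distrib]
    refine Finset.sum_le_sum fun f _ => ?_
    have hW : 0 ≤ ∏ j, w (f j) := Finset.prod_nonneg fun j _ => hw _
    set S := ∑ j, v (f j)
    rw [mul_left_comm, ← Real.exp_add]
    have e1 := mul_nonneg hW (Real.exp_pos (n * -(l * (s - t)) + a * (S - n * t))).le
    have e2 := mul_nonneg hW (Real.exp_pos (b * (S - n * s))).le
    split_ifs with h
    · rcases le_total S (n * s) with h' | h'
      · have : Real.exp (l * (S - n * s)) ≤ 1 :=
          Real.exp_le_one_iff.2 (mul_nonpos_of_nonneg_of_nonpos hl (by linarith))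
        nlinarith
      · have : Real.exp (l * (S - n * s)) ≤ Real.exp (b * (S - n * s)) :=
          Real.exp_le_exp.2 (mul_le_mul_of_nonneg_right hbl.le (by linarith))
        nlinarith
    · have : Real.exp (l * (S - n * s)) ≤ Real.exp (n * -(l * (s - t)) + a * (S - n * t)) := by
        refine Real.exp_le_exp.2 ?_
        push Not at h
        nlinarith
      nlinarith
  linarith

lemma upperTail_eq_zero {w v : ι → ℝ} (hw : ∀ i, 0 ≤ w i) {t : ℝ} (ht : ∀ i, 0 < w i → v i < t)
    {n : ℕ} (hn : 0 < n) : upperTail w v n t = 0 := by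
  refine Finset.sum_eq_zero fun f hf => ?_
  rw [Finset.mem_filter] at hf
  by_contra hne
  rw [← ne_eq, Finset.prod_ne_zero_iff] at hne
  have : ∑ j, v (f j) < ∑ _j : Fin n, t := by
    refine Finset.sum_lt_sum_of_nonempty ⟨⟨0, hn⟩, mem_univ _⟩ fun j hj => ht _ ?_
    exact lt_of_le_of_ne (hw _) (hne j hj).symm
  simp at this
  linarith [hf.2]

lemma upperTail_eq_one {w v : ι → ℝ} (hw1 : ∑ i, w i = 1) {t : ℝ}
    (ht : ∀ i, t ≤ v i) (n : ℕ) : upperTail w v n t = 1 := by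
  rw [← sum_prod_eq_one hw1 n, upperTail, Finset.filter_true_of_mem]
  intro f _
  have : ∑ _j : Fin n, t ≤ ∑ j, v (f j) := Finset.sum_le_sum fun j _ => ht _
  simpa using this

/-- Strict convexity of the moment in `l`, from a charged point away from `t`. -/
lemma strictMono_centredMomentDeriv {w v : ι → ℝ} (hw : ∀ i, 0 ≤ w i) {t : ℝ} {j : ι}
    (hj : 0 < w j) (hjt : t < v j) : StrictMono (centredMomentDeriv w v t) := by
  intro a b hab
  have hterm : ∀ u : ℝ, u * Real.exp (a * u) ≤ u * Real.exp (b * u) := by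
    intro u
    rcases le_total 0 u with hu | hu
    · exact mul_le_mul_of_nonneg_left (Real.exp_le_exp.2 (by nlinarith)) hu
    · exact mul_le_mul_of_nonpos_left (Real.exp_le_exp.2 (by nlinarith)) hu
  refine Finset.sum_lt_sum (fun i _ => mul_le_mul_of_nonneg_left (hterm _) (hw i))
    ⟨j, mem_univ j, mul_lt_mul_of_pos_left ?_ hj⟩
  have hu : 0 < v j - t := sub_pos.2 hjt
  exact mul_lt_mul_of_pos_left (Real.exp_lt_exp.2 (mul_lt_mul_of_pos_right hab hu)) hu

lemma exists_centredMomentDeriv_pos {w v : ι → ℝ} (hw : ∀ i, 0 ≤ w i) {t : ℝ} {j : ι}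
    (hj : 0 < w j) (hjt : t < v j) : ∃ l, 0 < l ∧ 0 < centredMomentDeriv w v t l := by
  classical
  have hu : 0 < v j - t := sub_pos.2 hjt
  have hlim : Tendsto (fun l : ℝ => w j * ((v j - t) * Real.exp (l * (v j - t)))) atTop atTop :=
    ((Real.tendsto_exp_atTop.comp (tendsto_id.atTop_mul_const hu)).const_mul_atTop
      hu).const_mul_atTop hj
  obtain ⟨l, hl, hl0⟩ := ((hlim.eventually_gt_atTop (∑ i, w i * |v i - t|)).and
    (eventually_gt_atTop 0)).exists
  refine ⟨l, hl0, ?_⟩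
  have hterm : ∀ u : ℝ, -|u| ≤ u * Real.exp (l * u) := by
    intro u
    rcases le_total 0 u with hu | hu
    · have := mul_nonneg hu (Real.exp_pos (l * u)).le
      linarith [abs_nonneg u]
    · rw [abs_of_nonpos hu, neg_neg]
      have : Real.exp (l * u) ≤ 1 := Real.exp_le_one_iff.2 (by nlinarith)
      nlinarith
  rw [centredMomentDeriv, ← Finset.add_sum_erase _ _ (mem_univ j)]
  have h2 : -∑ i, w i * |v i - t| ≤
      ∑ i ∈ univ.erase j, w i * ((v i - t) * Real.exp (l * (v i - t))) := by
    calc -∑ i, w i * |v i - t| ≤ -∑ i ∈ univ.erase j, w i * |v i - t| :=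
          neg_le_neg (Finset.sum_le_sum_of_subset_of_nonneg (Finset.subset_univ _)
            fun i _ _ => mul_nonneg (hw i) (abs_nonneg _))
      _ = ∑ i ∈ univ.erase j, w i * -|v i - t| := by simp
      _ ≤ _ := Finset.sum_le_sum fun i _ => mul_le_mul_of_nonneg_left (hterm _) (hw i)
  linarith

/-- Comparison of the tails of iterated convolutions near a point above the mean of the first
measure, under strict comparison of exponential moments. -/
lemma exists_upperTail_le {w v : ι → ℝ} {w' v' : κ → ℝ}
    (hw : ∀ i, 0 ≤ w i) (hw1 : ∑ i, w i = 1) (hw' : ∀ i, 0 ≤ w' i) (hw1' : ∑ i, w' i = 1)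
    (hlt : ∀ l, 0 < l → ∑ i, w i * Real.exp (l * v i) < ∑ i, w' i * Real.exp (l * v' i))
    (hmax : ∃ j, 0 < w' j ∧ ∀ i, 0 < w i → v i < v' j) {t : ℝ} (ht : ∑ i, w i * v i < t) :
    ∃ ε, 0 < ε ∧ ∀ᶠ n : ℕ in atTop, upperTail w v n (t - ε) ≤ upperTail w' v' n (t + ε) := by
  obtain ⟨j, hj, hjmax⟩ := hmax
  by_cases hcase : ∀ i, 0 < w i → v i < t
  · have h : ∀ᶠ ε in 𝓝[>] (0 : ℝ), ∀ i, 0 < w i → v i < t - ε := by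
      refine eventually_all.2 fun i => ?_
      by_cases hi : 0 < w i
      · have hc : Tendsto (fun ε : ℝ => t - ε) (𝓝[>] 0) (𝓝 t) := by
          have : Tendsto (fun ε : ℝ => t - ε) (𝓝 0) (𝓝 (t - 0)) := by
            apply Continuous.tendsto; fun_prop
          rw [sub_zero] at this
          exact this.mono_left nhdsWithin_le_nhds
        filter_upwards [hc.eventually (lt_mem_nhds (hcase i hi))] with ε hε _ using hε
      · exact Eventually.of_forall fun ε h => absurd h hi
    obtain ⟨ε, hε, hε0⟩ := (h.and self_mem_nhdsWithin).exists
    refine ⟨ε, hε0, ?_⟩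
    filter_upwards [eventually_gt_atTop 0] with n hn
    rw [upperTail_eq_zero hw hε hn]
    exact Finset.sum_nonneg fun f _ => Finset.prod_nonneg fun _ _ => hw' _
  push Not at hcase
  obtain ⟨i, hi, hit⟩ := hcase
  have hjt : t < v' j := hit.trans_lt (hjmax i hi)
  have hmono := strictMono_centredMomentDeriv hw' hj hjt
  -- the optimal tilt
  obtain ⟨a, ha, hDa, hat⟩ : ∃ a, 0 ≤ a ∧ 0 ≤ centredMomentDeriv w' v' t a ∧
      (a = 0 ∨ tiltedMean w' v' a = t) := by
    by_cases h0 : 0 ≤ centredMomentDeriv w' v' t 0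
    · exact ⟨0, le_rfl, h0, Or.inl rfl⟩
    push Not at h0
    obtain ⟨L, hL, hDL⟩ := exists_centredMomentDeriv_pos hw' hj hjt
    have hcont : Continuous (centredMomentDeriv w' v' t) := by
      unfold centredMomentDeriv; fun_prop
    obtain ⟨a, ha, haD⟩ := intermediate_value_Icc hL.le hcont.continuousOn ⟨h0.le, hDL.le⟩
    refine ⟨a, ha.1, haD.ge, Or.inr ?_⟩
    rw [centredMomentDeriv_eq hw' hw1'] at haD
    have := (mul_eq_zero.1 haD).resolve_left (centredMoment_pos hw' hw1' _ _).ne'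
    linarith
  -- If `a = 0` the right side is 1, and the gap comes from the mean of `w` lying below `t`; if `a >
  -- 0`, it comes from the strict moment comparison at `a`.
  obtain ⟨b, hb, hbK⟩ : ∃ b, 0 ≤ b ∧ centredMoment w v t b < centredMoment w' v' t a := by
    rcases ha.eq_or_lt with rfl | ha
    · have hD : centredMomentDeriv w v t 0 < 0 := by
        have : centredMomentDeriv w v t 0 = ∑ i, w i * v i - t := by
          simp [centredMomentDeriv, mul_sub, Finset.sum_sub_distrib, ← Finset.sum_mul, hw1]
        rw [this]; linarith
      obtain ⟨b, hb, hb0⟩ := ((eventually_lt_right_of_hasDerivAt_neg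
        (hasDerivAt_centredMoment w v t 0) hD).and self_mem_nhdsWithin).exists
      refine ⟨b, le_of_lt hb0, ?_⟩
      rwa [centredMoment_zero v' hw1', ← centredMoment_zero v hw1 t]
    · refine ⟨a, ha.le, ?_⟩
      rw [centredMoment_shift w v t 0, centredMoment_shift w' v' t 0]
      refine mul_lt_mul_of_pos_left ?_ (Real.exp_pos _)
      simpa [centredMoment] using hlt a ha
  obtain ⟨r, hr1, hr⟩ := exists_between hbK
  obtain ⟨q, hq1, hq⟩ := exists_between hr
  -- The summand `l - a` puts the upper level strictly above the tilted mean, yet vanishes in the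
  -- limit. If `a = 0` the level need not tend to `t`, but a moment at `l = 0` is 1 at any level.
  have hg : Tendsto (fun l => centredMoment w' v' (tiltedMean w' v' l + (l - a)) l) (𝓝[>] a)
      (𝓝 (centredMoment w' v' t a)) := by
    have hc : Continuous fun l => centredMoment w' v' (tiltedMean w' v' l + (l - a)) l := by
      have := continuous_tiltedMean (v := v') hw' hw1'
      unfold centredMoment; fun_prop
    have h := (hc.tendsto a).mono_left (nhdsWithin_le_nhds (s := Set.Ioi a))
    convert h using 2
    rcases hat with rfl | hat
    · rw [centredMoment_zero v' hw1', centredMoment_zero v' hw1']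
    · rw [hat, sub_self, add_zero]
  obtain ⟨l, hlq, hla⟩ := ((hg.eventually (lt_mem_nhds hq)).and self_mem_nhdsWithin).exists
  have hla : a < l := hla
  have hml : t < tiltedMean w' v' l := by
    have h := hDa.trans_lt (hmono hla)
    rw [centredMomentDeriv_eq hw' hw1'] at h
    have := pos_of_mul_pos_right h (centredMoment_pos hw' hw1' _ _).le
    linarith
  have hε1 : ∀ᶠ ε in 𝓝[>] (0 : ℝ), centredMoment w v (t - ε) b < r := by
    have hc : Continuous fun ε => centredMoment w v (t - ε) b := by
      unfold centredMoment; fun_prop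
    have h := (hc.tendsto 0).mono_left (nhdsWithin_le_nhds (s := Set.Ioi 0))
    rw [sub_zero] at h
    exact h.eventually (gt_mem_nhds hr1)
  have hε2 : ∀ᶠ ε in 𝓝[>] (0 : ℝ), ε < tiltedMean w' v' l - t :=
    nhdsWithin_le_nhds (gt_mem_nhds (sub_pos.2 hml))
  obtain ⟨ε, ⟨hε1, hε2⟩, hε0⟩ := ((hε1.and hε2).and self_mem_nhdsWithin).exists
  refine ⟨ε, hε0, ?_⟩
  have hr0 : 0 ≤ r := (centredMoment_pos hw hw1 _ _).le.trans hr1.le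
  filter_upwards [eventually_pow_le_upperTail hw' hw1' (t := t + ε)
      (s := tiltedMean w' v' l + (l - a)) (ha.trans hla.le) (by linarith) (by linarith),
    eventually_pow_le_mul_pow hr0 hq1 (show (0 : ℝ) < 1 / 2 by norm_num)] with n hn1 hn2
  calc upperTail w v n (t - ε) ≤ centredMoment w v (t - ε) b ^ n := upperTail_le_pow v hw n _ hb
    _ ≤ r ^ n := pow_le_pow_left₀ (centredMoment_pos hw hw1 _ _).le hε1.le n
    _ ≤ 1 / 2 * q ^ n := hn2
    _ ≤ 1 / 2 * centredMoment w' v' (tiltedMean w' v' l + (l - a)) l ^ n := by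
        have := pow_le_pow_left₀ (hr0.trans hq1.le) hlq.le n
        linarith
    _ ≤ _ := hn1

/-- Reflection turns lower tails into upper tails. The two events cover everything and overlap at `n
* t`; the reverse bound below therefore needs a gap `s < t`. -/
lemma one_le_upperTail_add_upperTail_neg {w : ι → ℝ} (v : ι → ℝ) (hw : ∀ i, 0 ≤ w i)
    (hw1 : ∑ i, w i = 1) (n : ℕ) (t : ℝ) :
    1 ≤ upperTail w v n t + upperTail w (fun i => -v i) n (-t) := by
  rw [← sum_prod_eq_one hw1 n, upperTail, upperTail, Finset.sum_filter, Finset.sum_filter,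
    ← Finset.sum_add_distrib]
  refine Finset.sum_le_sum fun f _ => ?_
  have hW : 0 ≤ ∏ j, w (f j) := Finset.prod_nonneg fun j _ => hw _
  rw [Finset.sum_neg_distrib]
  split_ifs <;> linarith

lemma upperTail_add_upperTail_neg_le {w : ι → ℝ} (v : ι → ℝ) (hw : ∀ i, 0 ≤ w i)
    (hw1 : ∑ i, w i = 1) {n : ℕ} (hn : 0 < n) {s t : ℝ} (hst : s < t) :
    upperTail w v n t + upperTail w (fun i => -v i) n (-s) ≤ 1 := by
  rw [← sum_prod_eq_one hw1 n, upperTail, upperTail, Finset.sum_filter, Finset.sum_filter,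
    ← Finset.sum_add_distrib]
  refine Finset.sum_le_sum fun f _ => ?_
  have hW : 0 ≤ ∏ j, w (f j) := Finset.prod_nonneg fun j _ => hw _
  have : (n : ℝ) * s < n * t := mul_lt_mul_of_pos_left hst (Nat.cast_pos.2 hn)
  rw [Finset.sum_neg_distrib]
  split_ifs <;> linarith

/-- If the exponential moments of two finitely supported probability measures compare strictly,
then high convolution powers are stochastically ordered. -/
theorem eventually_forall_upperTail_le {w v : ι → ℝ} {w' v' : κ → ℝ}
    (hw : ∀ i, 0 ≤ w i) (hw1 : ∑ i, w i = 1) (hw' : ∀ i, 0 ≤ w' i) (hw1' : ∑ i, w' i = 1)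
    (hpos : ∀ l, 0 < l → ∑ i, w i * Real.exp (l * v i) < ∑ i, w' i * Real.exp (l * v' i))
    (hneg : ∀ l, l < 0 → ∑ i, w' i * Real.exp (l * v' i) < ∑ i, w i * Real.exp (l * v i))
    (hmean : ∑ i, w i * v i < ∑ i, w' i * v' i)
    (hmax : ∃ j, 0 < w' j ∧ ∀ i, 0 < w i → v i < v' j)
    (hmin : ∃ i, 0 < w i ∧ ∀ j, 0 < w' j → v i < v' j) :
    ∀ᶠ n : ℕ in atTop, ∀ t, upperTail w v n t ≤ upperTail w' v' n t := by
  have hloc : ∀ t, ∃ ε, 0 < ε ∧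
      ∀ᶠ n : ℕ in atTop, upperTail w v n (t - ε) ≤ upperTail w' v' n (t + ε) := by
    intro t
    rcases lt_or_ge (∑ i, w i * v i) t with ht | ht
    · exact exists_upperTail_le hw hw1 hw' hw1' hpos hmax ht
    -- Here `t` lies below the mean of `w'`, so the reflected measures, with roles exchanged,
    -- satisfy the one-sided comparison at `-t`. Halving `ε` leaves the gap needed to pass to
    -- complements.
    obtain ⟨i, hi, hil⟩ := hmin
    obtain ⟨ε, hε, h⟩ := exists_upperTail_le (w := w') (v := fun i => -v' i) (w' := w)
      (v' := fun i => -v i) hw' hw1' hw hw1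
      (fun l hl => by simpa using hneg (-l) (by linarith))
      ⟨i, hi, fun j hj => neg_lt_neg (hil j hj)⟩ (t := -t) (by simp; linarith)
    refine ⟨ε / 2, by positivity, ?_⟩
    filter_upwards [h, eventually_gt_atTop 0] with n hn hn0
    have e1 := upperTail_add_upperTail_neg_le v hw hw1 hn0 (s := t - ε) (t := t - ε / 2)
      (by linarith)
    have e2 := one_le_upperTail_add_upperTail_neg v' hw' hw1' n (t + ε)
    have e3 := upperTail_anti v' hw' n (s := t + ε / 2) (t := t + ε) (by linarith)
    rw [show -(t - ε) = -t + ε by ring] at e1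
    rw [show -(t + ε) = -t - ε by ring] at e2
    linarith
  obtain ⟨R, hR, hR'⟩ : ∃ R : ℝ, (∀ i, v i ≤ R) ∧ ∀ j, -R ≤ v' j := by
    refine ⟨∑ i, |v i| + ∑ j, |v' j|, fun i => ?_, fun j => ?_⟩
    · have h1 := Finset.single_le_sum (f := fun i => |v i|) (fun i _ => abs_nonneg _) (mem_univ i)
      have h2 : 0 ≤ ∑ j, |v' j| := Finset.sum_nonneg fun j _ => abs_nonneg _
      have := le_abs_self (v i)
      linarith
    · have h1 := Finset.single_le_sum (f := fun i => |v' i|) (fun i _ => abs_nonneg _) (mem_univ j)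
      have h2 : 0 ≤ ∑ j, |v j| := Finset.sum_nonneg fun j _ => abs_nonneg _
      have := neg_abs_le (v' j)
      linarith
  -- By monotonicity of tails, one inequality between `t - ε` and `t + ε` serves the whole interval;
  -- compactness then gives a common `n`.
  have hcomp : ∀ᶠ n : ℕ in atTop, ∀ t ∈ Set.Icc (-R) R, upperTail w v n t ≤ upperTail w' v' n t := by
    refine IsCompact.induction_on
      (p := fun s => ∀ᶠ n : ℕ in atTop, ∀ t ∈ s, upperTail w v n t ≤ upperTail w' v' n t)
      isCompact_Icc (by simp) (fun s s' hs h => h.mono fun n hn t ht => hn t (hs ht))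
      (fun s s' h h' => ?_) (fun t _ => ?_)
    · filter_upwards [h, h'] with n hn hn' t ht
      exact ht.elim (hn t) (hn' t)
    · obtain ⟨ε, hε, h⟩ := hloc t
      refine ⟨Set.Ioo (t - ε) (t + ε),
        mem_nhdsWithin_of_mem_nhds (Ioo_mem_nhds (by linarith) (by linarith)), ?_⟩
      filter_upwards [h] with n hn u hu
      exact (upperTail_anti v hw n hu.1.le).trans (hn.trans (upperTail_anti v' hw' n hu.2.le))
  filter_upwards [hcomp, eventually_gt_atTop 0] with n hn hn0 t
  rcases lt_or_ge t (-R) with h1 | h1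
  · rw [upperTail_eq_one hw1' (fun j => h1.le.trans (hR' j))]
    exact upperTail_le_one v hw hw1 n t
  rcases lt_or_ge R t with h2 | h2
  · rw [upperTail_eq_zero hw (fun i _ => (hR i).trans_lt h2) hn0]
    exact Finset.sum_nonneg fun f _ => Finset.prod_nonneg fun _ _ => hw' _
  exact hn t ⟨h1, h2⟩

end Tails

end MultiCopy

/-! ### From threshold sums to majorization -/

namespace MultiCopy

open Finset

lemma sum_filter_le_eq_list_sum {ι : Type*} [Fintype ι] (z : ι → ℝ) (c : ℝ) :
    ∑ i with c ≤ z i, z i = ((decreasingRearrangement z).filter (c ≤ ·)).sum := by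
  rw [← Multiset.sum_coe, ← Multiset.filter_coe, decreasingRearrangement, Multiset.sort_eq,
    Multiset.filter_map, Finset.sum]
  rfl

lemma decreasingRearrangement_nonneg {ι : Type*} [Fintype ι] {z : ι → ℝ} (hz : ∀ i, 0 ≤ z i) :
    ∀ a ∈ decreasingRearrangement z, 0 ≤ a := by
  intro a ha
  simp only [decreasingRearrangement, Multiset.mem_sort, Multiset.mem_map] at ha
  obtain ⟨i, -, rfl⟩ := ha
  exact hz i

lemma length_decreasingRearrangement {ι : Type*} [Fintype ι] (z : ι → ℝ) :
    (decreasingRearrangement z).length = Fintype.card ι := by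
  simp [decreasingRearrangement]

lemma pairwise_decreasingRearrangement {ι : Type*} [Fintype ι] (z : ι → ℝ) :
    (decreasingRearrangement z).Pairwise (· ≥ ·) :=
  Multiset.pairwise_sort _ _

lemma list_sum_filter_le {l : List ℝ} (hl : ∀ a ∈ l, 0 ≤ a) (p : ℝ → Bool) :
    (l.filter p).sum ≤ l.sum := by
  induction l with
  | nil => simp
  | cons a l ih =>
    have h1 := ih fun b hb => hl b (List.mem_cons_of_mem a hb)
    have h2 := hl a List.mem_cons_self
    rw [List.filter_cons]
    split_ifs <;> simp <;> linarith

lemma list_sum_filter_eq_take_add_drop (l : List ℝ) (k : ℕ) (p : ℝ → Bool) :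
    (l.filter p).sum = ((l.take k).filter p).sum + ((l.drop k).filter p).sum := by
  rw [← List.sum_append, ← List.filter_append, List.take_append_drop]

/-- Domination of the masses above every positive threshold implies majorization. -/
lemma majorized_of_sum_filter_le {ι : Type*} [Fintype ι] {z z' : ι → ℝ} (hz : ∀ i, 0 ≤ z i)
    (hz' : ∀ i, 0 ≤ z' i)
    (h : ∀ c, 0 < c → ∑ i with c ≤ z i, z i ≤ ∑ i with c ≤ z' i, z' i) : Majorized z z' := by
  simp only [sum_filter_le_eq_list_sum] at h
  have hl := decreasingRearrangement_nonneg hz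
  have hl' := decreasingRearrangement_nonneg hz'
  have hn := length_decreasingRearrangement z
  have hn' := length_decreasingRearrangement z'
  have hs := pairwise_decreasingRearrangement z
  have hs' := pairwise_decreasingRearrangement z'
  suffices H : ∀ k, k ≤ Fintype.card ι → ((decreasingRearrangement z).take k).sum ≤
      ((decreasingRearrangement z').take k).sum from fun k _ hk => H k hk
  generalize decreasingRearrangement z = l at *
  generalize decreasingRearrangement z' = l' at *
  intro k
  induction k with
  | zero => simp
  | succ k ih =>
    intro hk
    have hkl : k < l.length := by omega
    have hkl' : k < l'.length := by omega
    have e : l.take (k + 1) = l.take k ++ [l[k]] := by simp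
    have e' : l'.take (k + 1) = l'.take k ++ [l'[k]] := by simp
    rcases le_or_gt l[k] l'[k] with hle | hlt
    · rw [e, e', List.sum_append, List.sum_append]
      have := ih (by omega)
      simp only [List.sum_singleton]
      linarith
    have h0' : 0 ≤ l'[k] := hl' _ (List.getElem_mem _)
    -- The threshold `l[k]` keeps the first `k + 1` entries of `l`, but none of `l'` beyond its
    -- first `k`.
    have hc := h l[k] (h0'.trans_lt hlt)
    have h1 : (l.take (k + 1)).sum ≤ (l.filter (l[k] ≤ ·)).sum := by
      rw [list_sum_filter_eq_take_add_drop _ (k + 1)]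
      have hf : (l.take (k + 1)).filter (l[k] ≤ ·) = l.take (k + 1) := by
        rw [List.filter_eq_self]
        intro a ha
        obtain ⟨i, hi, rfl⟩ := List.mem_take_iff_getElem.1 ha
        rw [decide_eq_true_iff]
        rcases (show i ≤ k by omega).eq_or_lt with rfl | hik
        · exact le_rfl
        · exact List.pairwise_iff_getElem.1 hs i k (by omega) hkl hik
      have hd : 0 ≤ ((l.drop (k + 1)).filter (l[k] ≤ ·)).sum :=
        List.sum_nonneg fun a ha => hl a (List.mem_of_mem_drop (List.mem_filter.1 ha).1)
      rw [hf]
      linarith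
    have h2 : (l'.filter (l[k] ≤ ·)).sum ≤ (l'.take k).sum := by
      rw [list_sum_filter_eq_take_add_drop _ k]
      have hf : (l'.drop k).filter (l[k] ≤ ·) = [] := by
        rw [List.filter_eq_nil_iff]
        intro a ha
        obtain ⟨i, hi, rfl⟩ := List.mem_drop_iff_getElem.1 ha
        rw [decide_eq_true_iff, not_le]
        refine lt_of_le_of_lt ?_ hlt
        rcases Nat.eq_zero_or_pos i with rfl | hi0
        · simp
        · exact List.pairwise_iff_getElem.1 hs' k (k + i) hkl' (by omega) (by omega)
      rw [hf, List.sum_nil, add_zero]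
      exact list_sum_filter_le (fun a ha => hl' a (List.mem_of_mem_take ha)) _
    rw [e', List.sum_append, List.sum_singleton]
    linarith

lemma tensorPower_nonneg {ι : Type*} {x : ι → ℝ} (hx : ∀ i, 0 ≤ x i) (n : ℕ) (f : Fin n → ι) :
    0 ≤ tensorPower n x f :=
  Finset.prod_nonneg fun _ _ => hx _

lemma sum_filter_tensorPower {ι : Type*} [Fintype ι] {x : ι → ℝ} (hx : ∀ i, 0 ≤ x i) {n : ℕ}
    (hn : 0 < n) {c : ℝ} (hc : 0 < c) :
    ∑ f with c ≤ tensorPower n x f, tensorPower n x f =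
      upperTail x (fun i => Real.log (x i)) n (Real.log c / n) := by
  rw [upperTail, Finset.sum_filter, Finset.sum_filter]
  refine Finset.sum_congr rfl fun f _ => ?_
  rw [mul_div_cancel₀ _ (Nat.cast_pos.2 hn).ne']
  rcases (tensorPower_nonneg hx n f).eq_or_lt with h | h
  -- The convention `log 0 = 0` is harmless: such a tuple has weight zero on both sides.
  · simp only [tensorPower] at h ⊢
    simp [← h]
  · have hne : ∀ j, x (f j) ≠ 0 := fun j => (Finset.prod_ne_zero_iff.1 h.ne') j (mem_univ j)
    have : ∑ j, Real.log (x (f j)) = Real.log (tensorPower n x f) :=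
      (Real.log_prod fun j _ => hne j).symm
    simp only [this, Real.log_le_log_iff hc h]
    rfl

lemma majorized_tensorPower_of_upperTail_le {ι : Type*} [Fintype ι] {x y : ι → ℝ}
    (hx : ∀ i, 0 ≤ x i) (hy : ∀ i, 0 ≤ y i) {n : ℕ} (hn : 0 < n)
    (h : ∀ t, upperTail x (fun i => Real.log (x i)) n t ≤
      upperTail y (fun i => Real.log (y i)) n t) :
    Majorized (tensorPower n x) (tensorPower n y) := by
  classical
  refine majorized_of_sum_filter_le (tensorPower_nonneg hx n) (tensorPower_nonneg hy n)
    fun c hc => ?_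
  rw [sum_filter_tensorPower hx hn hc, sum_filter_tensorPower hy hn hc]
  exact h _

end MultiCopy

/-! ### Perturbing `x` to make the moment inequalities strict -/

namespace MultiCopy

open Filter Topology Finset

/-- The moment `∑ xᵢ exp (l log xᵢ)`, which is `N (1 + l) x`. -/
noncomputable def logMoment {d : ℕ} (x : Fin d → ℝ) (l : ℝ) : ℝ :=
  ∑ i, x i * Real.exp (l * Real.log (x i))

/-- The vector `((1 - ε) x, ε)`. -/
def perturb {d : ℕ} (x : Fin d → ℝ) (ε : ℝ) : Fin (d + 1) → ℝ :=
  Fin.snoc (α := fun _ => ℝ) (fun i => (1 - ε) * x i) ε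

lemma N_eq_logMoment {d : ℕ} {x : Fin d → ℝ} (hx : ∀ i, 0 ≤ x i) (p : ℝ) :
    N p x = logMoment x (p - 1) := by
  rw [N, logMoment, Finset.sum_filter]
  refine Finset.sum_congr rfl fun i _ => ?_
  split_ifs with h
  · rw [Real.rpow_def_of_pos h]
    nth_rewrite 2 [← Real.exp_log h]
    rw [← Real.exp_add]
    congr 1; ring
  · rw [le_antisymm (not_lt.1 h) (hx i), zero_mul]

lemma perturb_mem_stdSimplex {d : ℕ} {x : Fin d → ℝ} (hx : x ∈ stdSimplex ℝ (Fin d)) {ε : ℝ}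
    (h0 : 0 ≤ ε) (h1 : ε ≤ 1) : perturb x ε ∈ stdSimplex ℝ (Fin (d + 1)) := by
  refine ⟨fun i => ?_, ?_⟩
  · refine Fin.lastCases ?_ (fun i => ?_) i
    · simpa [perturb] using h0
    · simpa [perturb] using mul_nonneg (sub_nonneg.2 h1) (hx.1 i)
  · simp [perturb, Fin.sum_univ_castSucc, ← Finset.mul_sum, hx.2]

lemma appendZero_mem_stdSimplex {d : ℕ} {x : Fin d → ℝ} (hx : x ∈ stdSimplex ℝ (Fin d)) :
    appendZero x ∈ stdSimplex ℝ (Fin (d + 1)) := by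
  have : appendZero x = perturb x 0 := by simp [appendZero, perturb]
  rw [this]
  exact perturb_mem_stdSimplex hx le_rfl zero_le_one

lemma logMoment_appendZero {d : ℕ} (x : Fin d → ℝ) (l : ℝ) :
    logMoment (appendZero x) l = logMoment x l := by
  simp [logMoment, appendZero, Fin.sum_univ_castSucc]

lemma logMoment_perturb {d : ℕ} {x : Fin d → ℝ} (hx : ∀ i, 0 ≤ x i) {ε : ℝ} (h1 : ε < 1) (l : ℝ) :
    logMoment (perturb x ε) l = (1 - ε) * Real.exp (l * Real.log (1 - ε)) * logMoment x l +
      ε * Real.exp (l * Real.log ε) := by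
  simp only [logMoment, perturb, Fin.sum_univ_castSucc, Fin.snoc_castSucc, Fin.snoc_last]
  rw [Finset.mul_sum]
  congr 1
  refine Finset.sum_congr rfl fun i _ => ?_
  rcases (hx i).eq_or_lt with h | h
  · simp [← h]
  · rw [Real.log_mul (by linarith) h.ne', mul_add, Real.exp_add]
    ring

lemma sum_mul_log_perturb {d : ℕ} {x : Fin d → ℝ} (hx : x ∈ stdSimplex ℝ (Fin d)) {ε : ℝ}
    (h1 : ε < 1) :
    ∑ i, perturb x ε i * Real.log (perturb x ε i) = (1 - ε) * Real.log (1 - ε) +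
      (1 - ε) * ∑ i, x i * Real.log (x i) + ε * Real.log ε := by
  simp only [perturb, Fin.sum_univ_castSucc, Fin.snoc_castSucc, Fin.snoc_last]
  have : (1 - ε) * Real.log (1 - ε) = ∑ i, x i * ((1 - ε) * Real.log (1 - ε)) := by
    rw [← Finset.sum_mul, hx.2, one_mul]
  rw [this, Finset.mul_sum, ← Finset.sum_add_distrib]
  congr 1
  refine Finset.sum_congr rfl fun i _ => ?_
  rcases (hx.1 i).eq_or_lt with h | h
  · simp [← h]
  · rw [Real.log_mul (by linarith) h.ne']
    ring

lemma centredMoment_log {d : ℕ} (x : Fin d → ℝ) :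
    centredMoment x (fun i => Real.log (x i)) 0 = logMoment x := by
  ext l; simp [centredMoment, logMoment]

lemma logMoment_pos {d : ℕ} {x : Fin d → ℝ} (hx : x ∈ stdSimplex ℝ (Fin d)) (l : ℝ) :
    0 < logMoment x l := by
  rw [← centredMoment_log]
  exact centredMoment_pos hx.1 hx.2 0 l

lemma logMoment_zero {d : ℕ} {x : Fin d → ℝ} (hx : x ∈ stdSimplex ℝ (Fin d)) :
    logMoment x 0 = 1 := by
  simp [logMoment, hx.2]

lemma continuous_logMoment {d : ℕ} (x : Fin d → ℝ) : Continuous (logMoment x) := by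
  unfold logMoment; fun_prop

lemma hasDerivAt_logMoment_zero {d : ℕ} (x : Fin d → ℝ) :
    HasDerivAt (logMoment x) (∑ i, x i * Real.log (x i)) 0 := by
  have h := hasDerivAt_centredMoment x (fun i => Real.log (x i)) 0 0
  rw [centredMoment_log] at h
  simpa [centredMomentDeriv] using h

/-- Both moments equal 1 at `l = 0`, so their right derivatives there compare. -/
lemma sum_mul_log_le {d : ℕ} {x y : Fin d → ℝ} (hx : x ∈ stdSimplex ℝ (Fin d))
    (hy : y ∈ stdSimplex ℝ (Fin d)) (h : ∀ l, 0 ≤ l → logMoment x l ≤ logMoment y l) :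
    ∑ i, x i * Real.log (x i) ≤ ∑ i, y i * Real.log (y i) := by
  by_contra! hlt
  obtain ⟨l, hl, hl0⟩ := ((eventually_lt_right_of_hasDerivAt_neg
    ((hasDerivAt_logMoment_zero y).sub (hasDerivAt_logMoment_zero x))
    (sub_neg.2 hlt)).and self_mem_nhdsWithin).exists
  have := h l (le_of_lt hl0)
  simp only [Pi.sub_apply, logMoment_zero hx, logMoment_zero hy] at hl
  linarith

lemma le_max_of_logMoment_le {d : ℕ} {x y : Fin d → ℝ} (hx : x ∈ stdSimplex ℝ (Fin d))
    (hy : y ∈ stdSimplex ℝ (Fin d)) (h : ∀ l, 0 ≤ l → logMoment x l ≤ logMoment y l)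
    {Y : ℝ} (hY : ∀ j, y j ≤ Y) (hY0 : 0 < Y) (i : Fin d) : x i ≤ Y := by
  by_contra! hlt
  have hi : 0 < x i := hY0.trans hlt
  have hc : 0 < Real.log (x i) - Real.log Y := sub_pos.2 (Real.log_lt_log hY0 hlt)
  set c := Real.log (x i) - Real.log Y with hcdef
  -- Large enough for the growth of `(x i / Y) ^ l` to outweigh the prefactor `x i`.
  set l := (|Real.log (x i)| + 1) / c with hl
  have hl0 : 0 ≤ l := by positivity
  have h1 : x i * Real.exp (l * Real.log (x i)) ≤ logMoment x l :=
    Finset.single_le_sum (f := fun i => x i * Real.exp (l * Real.log (x i)))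
      (fun i _ => mul_nonneg (hx.1 i) (Real.exp_pos _).le) (mem_univ i)
  have h2 : logMoment y l ≤ Real.exp (l * Real.log Y) := by
    calc logMoment y l ≤ ∑ j, y j * Real.exp (l * Real.log Y) := by
          refine Finset.sum_le_sum fun j _ => ?_
          rcases (hy.1 j).eq_or_lt with hj | hj
          · simp [← hj]
          · exact mul_le_mul_of_nonneg_left (Real.exp_le_exp.2
              (mul_le_mul_of_nonneg_left (Real.log_le_log hj (hY j)) hl0)) hj.le
      _ = _ := by rw [← Finset.sum_mul, hy.2, one_mul]
  have h3 := h1.trans ((h l hl0).trans h2)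
  nth_rewrite 1 [← Real.exp_log hi] at h3
  rw [← Real.exp_add, Real.exp_le_exp] at h3
  have h4 : l * c = |Real.log (x i)| + 1 := div_mul_cancel₀ _ hc.ne'
  have h5 := neg_abs_le (Real.log (x i))
  rw [hcdef, mul_sub] at h4
  linarith

lemma eventually_lt_of_pos {ι : Type*} [Finite ι] (x : ι → ℝ) :
    ∀ᶠ ε in 𝓝[>] (0 : ℝ), ∀ i, 0 < x i → ε < x i := by
  refine eventually_all.2 fun i => ?_
  by_cases hi : 0 < x i
  · filter_upwards [nhdsWithin_le_nhds (gt_mem_nhds hi)] with ε hε _ using hε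
  · exact Eventually.of_forall fun ε h => absurd h hi

lemma mul_exp_mul_log {a : ℝ} (ha : 0 < a) (l : ℝ) :
    a * Real.exp (l * Real.log a) = Real.exp ((1 + l) * Real.log a) := by
  nth_rewrite 1 [← Real.exp_log ha]
  rw [← Real.exp_add]
  congr 1; ring

/-- At `l = -1` the weak inequality survives by continuity, so nearby the moment of `y` exceeds that
of `x` by less than 1, while the added term is at least 1. Further left, an `ε` far below the
positive entries of `y` makes the added term dominate. -/
lemma eventually_logMoment_lt_add {d : ℕ} {x y : Fin d → ℝ} (hx : x ∈ stdSimplex ℝ (Fin d))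
    (hy : y ∈ stdSimplex ℝ (Fin d))
    (h : ∀ l, -1 < l → l ≤ 0 → logMoment y l ≤ logMoment x l) :
    ∀ᶠ ε in 𝓝[>] (0 : ℝ), ∀ l ≤ -1,
      logMoment y l < logMoment x l + ε * Real.exp (l * Real.log ε) := by
  have hcont : Continuous fun l => logMoment y l - logMoment x l :=
    (continuous_logMoment y).sub (continuous_logMoment x)
  have h1 : logMoment y (-1) - logMoment x (-1) ≤ 0 := by
    refine le_of_tendsto ((hcont.tendsto (-1)).mono_left
      (nhdsWithin_le_nhds (s := Set.Ioi (-1)))) ?_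
    filter_upwards [Ioo_mem_nhdsGT (show (-1 : ℝ) < 0 by norm_num)] with l hl
    exact sub_nonpos.2 (h l hl.1 hl.2.le)
  obtain ⟨δ, hδ, hδ'⟩ := Metric.eventually_nhds_iff.1
    ((hcont.tendsto (-1)).eventually (gt_mem_nhds (h1.trans_lt zero_lt_one)))
  obtain ⟨m, hm, hm0⟩ := ((eventually_lt_of_pos y).and self_mem_nhdsWithin).exists
  have hm0 : 0 < m := hm0
  -- The margin `d / δ` makes `(m / ε) ^ δ` exceed `exp d`, which absorbs the number `d` of
  -- summands.
  have hlog : ∀ᶠ ε in 𝓝[>] (0 : ℝ), Real.log ε < Real.log m - d / δ :=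
    Real.tendsto_log_nhdsGT_zero.eventually (eventually_lt_atBot _)
  filter_upwards [hlog, self_mem_nhdsWithin, nhdsWithin_le_nhds (gt_mem_nhds one_pos)]
    with ε hε hε0 hε1 l hl
  have hε0 : 0 < ε := hε0
  rw [mul_exp_mul_log hε0]
  rcases lt_or_ge (-1 - δ) l with hl' | hl'
  · have e1 : logMoment y l - logMoment x l < 1 := by
      apply hδ'
      rw [Real.dist_eq, abs_lt]
      constructor <;> linarith
    have e2 : 1 ≤ Real.exp ((1 + l) * Real.log ε) :=
      Real.one_le_exp (mul_nonneg_of_nonpos_of_nonpos (by linarith)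
        (Real.log_nonpos hε0.le hε1.le))
    linarith
  · have e1 : logMoment y l ≤ d * Real.exp ((1 + l) * Real.log m) := by
      calc logMoment y l ≤ ∑ _j : Fin d, Real.exp ((1 + l) * Real.log m) := by
            refine Finset.sum_le_sum fun j _ => ?_
            rcases (hy.1 j).eq_or_lt with hj | hj
            · rw [← hj, zero_mul]; exact (Real.exp_pos _).le
            · rw [mul_exp_mul_log hj]
              exact Real.exp_le_exp.2 (mul_le_mul_of_nonpos_left
                (Real.log_le_log hm0 (hm j hj).le) (by linarith))
        _ = _ := by simp
    have e2 : (d : ℝ) * Real.exp ((1 + l) * Real.log m) ≤ Real.exp ((1 + l) * Real.log ε) := by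
      calc (d : ℝ) * Real.exp ((1 + l) * Real.log m) ≤
          Real.exp d * Real.exp ((1 + l) * Real.log m) := by
            refine mul_le_mul_of_nonneg_right ?_ (Real.exp_pos _).le
            linarith [Real.add_one_le_exp (d : ℝ)]
        _ ≤ _ := by
            rw [← Real.exp_add, Real.exp_le_exp]
            have e3 : (d : ℝ) = δ * (d / δ) := by field_simp
            have e4 : 0 ≤ (d : ℝ) / δ := by positivity
            nlinarith
    linarith [logMoment_pos hx l]

/-- The moment `logMoment x l` is an `x`-weighted average of the powers `x i ^ l`, hence at least `ε
^ l`; strictness comes from `(1 - ε) ^ l < 1`. -/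
lemma logMoment_perturb_lt {d : ℕ} {x : Fin d → ℝ} (hx : x ∈ stdSimplex ℝ (Fin d)) {ε : ℝ}
    (h0 : 0 < ε) (h1 : ε < 1) (hεx : ∀ i, 0 < x i → ε < x i) {l : ℝ} (hl : 0 < l) :
    logMoment (perturb x ε) l < logMoment x l := by
  rw [logMoment_perturb hx.1 h1]
  have e1 : Real.exp (l * Real.log ε) ≤ logMoment x l := by
    rw [← one_mul (Real.exp _), ← hx.2, Finset.sum_mul]
    refine Finset.sum_le_sum fun i _ => ?_
    rcases (hx.1 i).eq_or_lt with hi | hi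
    · simp [← hi]
    · exact mul_le_mul_of_nonneg_left (Real.exp_le_exp.2
        (mul_le_mul_of_nonneg_left (Real.log_le_log h0 (hεx i hi).le) hl.le)) hi.le
  have e2 : Real.exp (l * Real.log (1 - ε)) < 1 :=
    Real.exp_lt_one_iff.2 (mul_neg_of_pos_of_neg hl (Real.log_neg (by linarith) (by linarith)))
  have e3 := mul_pos (mul_pos (sub_pos.2 h1) (sub_pos.2 e2)) (logMoment_pos hx l)
  have e4 := mul_le_mul_of_nonneg_left e1 h0.le
  linarith

lemma lt_logMoment_perturb {d : ℕ} {x : Fin d → ℝ} (hx : x ∈ stdSimplex ℝ (Fin d)) {ε : ℝ}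
    (h0 : 0 < ε) (h1 : ε < 1) (hεx : ∀ i, 0 < x i → ε < x i) {l : ℝ} (hl : l < 0) :
    logMoment x l < logMoment (perturb x ε) l := by
  rw [logMoment_perturb hx.1 h1]
  have e1 : logMoment x l ≤ Real.exp (l * Real.log ε) := by
    rw [← one_mul (Real.exp _), ← hx.2, Finset.sum_mul]
    refine Finset.sum_le_sum fun i _ => ?_
    rcases (hx.1 i).eq_or_lt with hi | hi
    · simp [← hi]
    · exact mul_le_mul_of_nonneg_left (Real.exp_le_exp.2
        (mul_le_mul_of_nonpos_left (Real.log_le_log h0 (hεx i hi).le) hl.le)) hi.le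
  have e2 : 1 < Real.exp (l * Real.log (1 - ε)) :=
    Real.one_lt_exp_iff.2 (mul_pos_of_neg_of_neg hl (Real.log_neg (by linarith) (by linarith)))
  have e3 := mul_pos (mul_pos (sub_pos.2 h1) (sub_pos.2 e2)) (logMoment_pos hx l)
  have e4 := mul_le_mul_of_nonneg_left e1 h0.le
  linarith

lemma sum_mul_log_perturb_lt {d : ℕ} {x : Fin d → ℝ} (hx : x ∈ stdSimplex ℝ (Fin d)) {ε : ℝ}
    (h0 : 0 < ε) (h1 : ε < 1) (hεx : ∀ i, 0 < x i → ε < x i) :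
    ∑ i, perturb x ε i * Real.log (perturb x ε i) < ∑ i, x i * Real.log (x i) := by
  rw [sum_mul_log_perturb hx h1]
  have e1 : Real.log ε ≤ ∑ i, x i * Real.log (x i) := by
    rw [← one_mul (Real.log ε), ← hx.2, Finset.sum_mul]
    refine Finset.sum_le_sum fun i _ => ?_
    rcases (hx.1 i).eq_or_lt with hi | hi
    · simp [← hi]
    · exact mul_le_mul_of_nonneg_left (Real.log_le_log h0 (hεx i hi).le) hi.le
  have e2 : (1 - ε) * Real.log (1 - ε) < 0 :=
    mul_neg_of_pos_of_neg (sub_pos.2 h1) (Real.log_neg (by linarith) (by linarith))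
  have e4 := mul_le_mul_of_nonneg_left e1 h0.le
  linarith

lemma eventually_perturb_mem_M {d : ℕ} {x y : Fin d → ℝ}
    (hx : x ∈ stdSimplex ℝ (Fin d)) (hy : y ∈ stdSimplex ℝ (Fin d))
    (h1 : ∀ l, 0 ≤ l → logMoment x l ≤ logMoment y l)
    (h2 : ∀ l, -1 < l → l ≤ 0 → logMoment y l ≤ logMoment x l) :
    ∀ᶠ ε in 𝓝[>] (0 : ℝ), perturb x ε ∈ M (appendZero y) := by
  filter_upwards [eventually_logMoment_lt_add hx hy h2, eventually_lt_of_pos x,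
    eventually_lt_of_pos y, self_mem_nhdsWithin, nhdsWithin_le_nhds (gt_mem_nhds one_pos)]
    with ε hε hεx hεy h0 hε1
  have h0 : 0 < ε := h0
  have hu := perturb_mem_stdSimplex hx h0.le hε1.le
  have hy' := appendZero_mem_stdSimplex hy
  refine ⟨hu, ?_⟩
  have hdom := eventually_forall_upperTail_le (v := fun i => Real.log (perturb x ε i))
    (v' := fun i => Real.log (appendZero y i)) hu.1 hu.2 hy'.1 hy'.2 ?_ ?_ ?_ ?_ ?_
  · obtain ⟨n, hn, hn2⟩ := (hdom.and (eventually_ge_atTop 2)).exists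
    exact ⟨n, hn2, majorized_tensorPower_of_upperTail_le hu.1 hy'.1 (by omega) hn⟩
  · intro l hl
    change logMoment _ l < logMoment _ l
    rw [logMoment_appendZero]
    exact (logMoment_perturb_lt hx h0 hε1 hεx hl).trans_le (h1 l hl.le)
  · intro l hl
    change logMoment _ l < logMoment _ l
    rw [logMoment_appendZero]
    rcases lt_or_ge (-1) l with hl' | hl'
    · exact (h2 l hl' hl.le).trans_lt (lt_logMoment_perturb hx h0 hε1 hεx hl)
    · refine (hε l hl').trans_le ?_
      rw [logMoment_perturb hx.1 hε1, mul_exp_mul_log (sub_pos.2 hε1)]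
      have : 1 ≤ Real.exp ((1 + l) * Real.log (1 - ε)) :=
        Real.one_le_exp (mul_nonneg_of_nonpos_of_nonpos (by linarith)
          (Real.log_nonpos (by linarith) (by linarith)))
      have := le_mul_of_one_le_left (logMoment_pos hx l).le this
      linarith
  · refine (sum_mul_log_perturb_lt hx h0 hε1 hεx).trans_le ((sum_mul_log_le hx hy h1).trans_eq ?_)
    simp [appendZero, Fin.sum_univ_castSucc]
  · have hne : ∃ i, 0 < x i := by
      by_contra! h
      have : ∑ i, x i ≤ 0 := Finset.sum_nonpos fun i _ => h i
      linarith [hx.2]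
    obtain ⟨i₀, hi₀⟩ := hne
    have : Nonempty (Fin d) := ⟨i₀⟩
    obtain ⟨j, hj⟩ := Finite.exists_max y
    have hj0 : 0 < y j := by
      by_contra! h
      have : ∑ i, y i ≤ 0 := Finset.sum_nonpos fun i _ => (hj i).trans h
      linarith [hy.2]
    have hmax := le_max_of_logMoment_le hx hy h1 hj hj0
    refine ⟨Fin.castSucc j, by simpa [appendZero] using hj0, fun i hi => ?_⟩
    refine Real.log_lt_log hi ?_
    revert hi
    refine Fin.lastCases ?_ (fun i => ?_) i
    · intro _
      simpa [perturb, appendZero] using hεy j hj0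
    · intro hi
      simp only [perturb, appendZero, Fin.snoc_castSucc] at hi ⊢
      have := pos_of_mul_pos_right hi (sub_pos.2 hε1).le
      nlinarith [hmax i]
  · refine ⟨Fin.last d, by simpa [perturb] using h0, fun j hj => ?_⟩
    simp only [perturb, Fin.snoc_last]
    refine Real.log_lt_log h0 ?_
    revert hj
    refine Fin.lastCases ?_ (fun j => ?_) j
    · simp [appendZero]
    · simpa [appendZero] using hεy j

lemma continuous_perturb {d : ℕ} (x : Fin d → ℝ) : Continuous (perturb x) := by
  refine continuous_pi fun i => ?_
  refine Fin.lastCases ?_ (fun i => ?_) i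
  · simpa [perturb] using continuous_id'
  · simp only [perturb, Fin.snoc_castSucc]
    fun_prop

end MultiCopy

theorem mainTheorem4 (d : ℕ) (x y : Fin d → ℝ)
    (hx : x ∈ stdSimplex ℝ (Fin d)) (hy : y ∈ stdSimplex ℝ (Fin d))
    (h1 : ∀ p : ℝ, 1 ≤ p → MultiCopy.N p x ≤ MultiCopy.N p y)
    (h2 : ∀ p : ℝ, 0 < p → p ≤ 1 → MultiCopy.N p y ≤ MultiCopy.N p x) :
    ∃ u : ℕ → (Fin (d + 1) → ℝ),
      (∀ n, u n ∈ MultiCopy.M (MultiCopy.appendZero y)) ∧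
        Filter.Tendsto u Filter.atTop (nhds (MultiCopy.appendZero x)) := by
  have hev := MultiCopy.eventually_perturb_mem_M hx hy
    (fun l hl => by
      simpa [MultiCopy.N_eq_logMoment hx.1, MultiCopy.N_eq_logMoment hy.1] using
        h1 (l + 1) (by linarith))
    (fun l hl hl0 => by
      simpa [MultiCopy.N_eq_logMoment hx.1, MultiCopy.N_eq_logMoment hy.1] using
        h2 (l + 1) (by linarith) (by linarith))
  have hlim : Filter.Tendsto (fun n : ℕ => 1 / ((n : ℝ) + 1)) Filter.atTop
      (nhdsWithin 0 (Set.Ioi 0)) :=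
    tendsto_nhdsWithin_iff.2 ⟨tendsto_one_div_add_atTop_nhds_zero_nat,
      Filter.Eventually.of_forall fun n => Set.mem_Ioi.2 Nat.one_div_pos_of_nat⟩
  -- Membership holds only for small `ε`, so the sequence starts at index `n₀`.
  obtain ⟨n₀, hn₀⟩ := Filter.eventually_atTop.1 (hlim.eventually hev)
  refine ⟨fun n => MultiCopy.perturb x (1 / (((n + n₀ : ℕ) : ℝ) + 1)),
    fun n => hn₀ _ (Nat.le_add_left _ _), ?_⟩
  have h0 : MultiCopy.appendZero x = MultiCopy.perturb x 0 := by
    simp [MultiCopy.appendZero, MultiCopy.perturb]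
  rw [h0]
  exact ((MultiCopy.continuous_perturb x).tendsto 0).comp
    ((hlim.mono_right nhdsWithin_le_nhds).comp (Filter.tendsto_add_atTop_nat n₀))
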